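/- Let $1<p\le\infty$ and $1/p+1/p^{*}=1$ (so $p^{*}=1$ if $p=\infty$). Banach spaces are real, and base points of pointed metric spaces are denoted by $0$. For a pointed metric space $X$ and Banach spaces $E,F$, let $LipL_0(X\times E;F)$ be the set of maps $T:X\times E\to F$ such that $T(x,\cdot)$ is linear for every $x\in X$, $T(0,\cdot)=0$, and, for some $C>0$, $\|T(x,e)-T(y,e)\|\le C\,d(x,y)\|e\|$ for all $x,y\in X$, $e\in E$; let $LipL(T)$ be the infimum of these $C$. An operator $u\in\mathcal L(G;F)$ between Banach spaces belongs to $\mathcal D_p(G;F)$ if there is $C>0$ such that $$\sum_{i=1}^n|\langle u(g_i),z_i^*\rangle|\le C\Big(\sum_{i=1}^n\|g_i\|^p\Big)^{1/p}\sup_{z^{**}\in B_{F^{**}}}\Big(\sum_{i=1}^n|z^{**}(z_i^*)|^{p^*}\Big)^{1/p^*}$$ for all $n$, $g_1,\dots,g_n\in G$ and $z_1^*,\dots,z_n^*\in F^*$ (with a maximum in place of the $p$-sum if $p=\infty$); $d_p(u)$ is the infimum of these $C$. An operator $T\in LipL_0(X\times E;F)$ belongs to $\mathcal D_p^{LipL}(X\times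 E;F)$ (is Cohen strongly $p$-summing) if there is $C>0$ such that $$\sum_{i=1}^n|\langle T(x_i,e_i)-T(y_i,e_i),z_i^*\rangle|\le C\Big(\sum_{i=1}^n\big(d(x_i,y_i)\|e_i\|\big)^p\Big)^{1/p}\sup_{z^{**}\in B_{F^{**}}}\Big(\sum_{i=1}^n|z^{**}(z_i^*)|^{p^*}\Big)^{1/p^*}$$ for all $n$, $x_i,y_i\in X$, $e_i\in E$, $z_i^*\in F^*$ $(1\le i\le n)$ (again with a maximum if $p=\infty$); $d_p^{LipL}(T)$ is the infimum of these $C$. Finally, $T\in LipL_0(X\times E;F)$ belongs to $\mathcal D_p\circ LipL_0(X\times E;F)$ if $T=u\circ S$ for some Banach space $G$, $S\in LipL_0(X\times E;G)$ and $u\in\mathcal D_p(G;F)$; $\|T\|_{\mathcal D_p\circ LipL_0}$ is the infimum of $d_p(u)\,LipL(S)$ over all such factorizations. A Banach Lip-linear ideal is a subclass $\mathcal I$ of $LipL_0$ with a function $\|\cdot\|_{\mathcal I}:\mathcal I\to[0,\infty)$ such that, for all pointed metric spaces $X,X_0$ and Banach spaces $E,E_0,F,F_0$: (i) $\mathcal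 I(X\times E;F)$ is a vector subspace of $LipL_0(X\times E;F)$, it is a Banach space under $\|\cdot\|_{\mathcal I}$, and $LipL(T)\le\|T\|_{\mathcal I}$ for each $T$ in it; (ii) for every Lipschitz $f:X\to\mathbb R$ with $f(0)=0$, $e^*\in E^*$ and $z\in F$, the map $(x,e)\mapsto f(x)e^*(e)z$ is in $\mathcal I(X\times E;F)$; and the map $\mathbb R\times\mathbb R\to\mathbb R$, $(\alpha,\beta)\mapsto\alpha\beta$, has $\|\cdot\|_{\mathcal I}$ equal to $1$; (iii) if $f:X\to X_0$ is Lipschitz with least constant $Lip(f)$ and $f(0)=0$, $v\in\mathcal L(E;E_0)$, $T\in\mathcal I(X_0\times E_0;F_0)$ and $u\in\mathcal L(F_0;F)$, then $u\circ T\circ(f,v)\in\mathcal I(X\times E;F)$ and $\|u\circ T\circ(f,v)\|_{\mathcal I}\le\|u\|\,\|T\|_{\mathcal I}\,Lip(f)\,\|v\|$. Then $(\mathcal D_p^{LipL},d_p^{LipL})$ is a Banach Lip-linear ideal, and it is the one generated from $(\mathcal D_p,d_p)$ by composition: for all pointed metric spaces $X$ and Banach spaces $E,F$, $$\mathcal D_p^{LipL}(X\times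 E;F)=\mathcal D_p\circ LipL_0(X\times E;F),\qquad d_p^{LipL}(T)=\|T\|_{\mathcal D_p\circ LipL_0}\ \text{ for every } T \text{ in this space.}$$ -/

import Mathlib

open scoped ENNReal

universe u

namespace CohenLip

noncomputable section

/-! Throughout, scalars are real and a pointed metric space is a metric space `X` together with a
distinguished point, written `0` (an instance of `Zero X`). -/

/-- The `ℓ_p` norm of a finite family of real numbers (the maximum of the absolute values
for `p = ∞`). -/
def finLpNorm (p : ℝ≥0∞) {n : ℕ} (a : Fin n → ℝ) : ℝ :=
  ‖(WithLp.toLp p a : PiLp p (fun _ : Fin n => ℝ))‖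

/-- The weak `ℓ_q` norm of a finite family of vectors of a normed space `E`, a supremum over
the closed unit ball of the dual of `E`. -/
def weakLpNorm {E : Type u} [NormedAddCommGroup E] [NormedSpace ℝ E] (q : ℝ≥0∞) {n : ℕ}
    (z : Fin n → E) : ℝ :=
  ⨆ φ : Metric.closedBall (0 : StrongDual ℝ E) 1,
    finLpNorm q (fun i => (φ : StrongDual ℝ E) (z i))

/-- The least Lipschitz constant of a Lipschitz map between metric spaces. -/
def lipConst {X Y : Type u} [MetricSpace X] [MetricSpace Y] (f : X → Y) : ℝ :=
  sSup {r : ℝ | ∃ x y : X, x ≠ y ∧ r = dist (f x) (f y) / dist x y}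

/-- `Lip₀(X; Y)`: Lipschitz maps that preserve the base point. -/
def Lip0 (X Y : Type u) [MetricSpace X] [Zero X] [MetricSpace Y] [Zero Y] : Set (X → Y) :=
  {f | (∃ C : ℝ, ∀ x y : X, dist (f x) (f y) ≤ C * dist x y) ∧ f 0 = 0}

/-- `T` satisfies the Lip-linear estimate with the constant `C`. -/
def LipLBound {X E F : Type u} [MetricSpace X] [NormedAddCommGroup E] [NormedAddCommGroup F]
    (T : X × E → F) (C : ℝ) : Prop :=
  ∀ (x y : X) (e : E), ‖T (x, e) - T (y, e)‖ ≤ C * dist x y * ‖e‖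

/-- `LipL₀(X × E; F)`: Lip-linear operators that vanish on `{0} × E`. -/
def LipL0 (X E F : Type u) [MetricSpace X] [Zero X] [NormedAddCommGroup E] [NormedSpace ℝ E]
    [NormedAddCommGroup F] [NormedSpace ℝ F] : Set (X × E → F) :=
  {T | (∀ x : X, IsLinearMap ℝ (fun e : E => T (x, e))) ∧
    (∃ C : ℝ, 0 < C ∧ LipLBound T C) ∧ ∀ e : E, T (0, e) = 0}

/-- The norm `LipL(T)`. -/
def lipLNorm {X E F : Type u} [MetricSpace X] [NormedAddCommGroup E] [NormedAddCommGroup F]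
    (T : X × E → F) : ℝ :=
  sInf {C : ℝ | 0 < C ∧ LipLBound T C}

/-- A class of bounded linear operators, with its components and a size function on them
(no axioms are imposed here). -/
structure OpClass where
  mem : ∀ (E F : Type u) [NormedAddCommGroup E] [NormedSpace ℝ E] [NormedAddCommGroup F]
    [NormedSpace ℝ F], Set (E →L[ℝ] F)
  size : ∀ (E F : Type u) [NormedAddCommGroup E] [NormedSpace ℝ E] [NormedAddCommGroup F]
    [NormedSpace ℝ F], (E →L[ℝ] F) → ℝ

/-- A class of maps `X × E → F`, with its components and a size function on them
(no axioms are imposed here). -/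
structure LipLClass where
  mem : ∀ (X E F : Type u) [MetricSpace X] [Zero X] [NormedAddCommGroup E] [NormedSpace ℝ E]
    [NormedAddCommGroup F] [NormedSpace ℝ F], Set (X × E → F)
  size : ∀ (X E F : Type u) [MetricSpace X] [Zero X] [NormedAddCommGroup E] [NormedSpace ℝ E]
    [NormedAddCommGroup F] [NormedSpace ℝ F], (X × E → F) → ℝ

/-- `u` satisfies the strongly `p`-summing inequality with the constant `C`. -/
def StronglySummingBound {E F : Type u} [NormedAddCommGroup E] [NormedSpace ℝ E]
    [NormedAddCommGroup F] [NormedSpace ℝ F] (p : ℝ≥0∞) (u : E →L[ℝ] F) (C : ℝ) : Prop :=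
  ∀ (n : ℕ) (x : Fin n → E) (z : Fin n → StrongDual ℝ F),
    ∑ i, |z i (u (x i))| ≤
      C * finLpNorm p (fun i => ‖x i‖) * weakLpNorm p.conjExponent z

/-- `(𝒟_p, d_p)`: the strongly `p`-summing linear operators. -/
def stronglySumming (p : ℝ≥0∞) : OpClass.{u} where
  mem := fun _ _ _ _ _ _ => {u | ∃ C : ℝ, 0 < C ∧ StronglySummingBound p u C}
  size := fun _ _ _ _ _ _ u => sInf {C : ℝ | 0 < C ∧ StronglySummingBound p u C}

/-- `T` satisfies the Cohen strongly `p`-summing inequality with the constant `C`. -/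
def CohenBound {X E F : Type u} [MetricSpace X] [NormedAddCommGroup E]
    [NormedAddCommGroup F] [NormedSpace ℝ F] (p : ℝ≥0∞) (T : X × E → F) (C : ℝ) : Prop :=
  ∀ (n : ℕ) (x y : Fin n → X) (e : Fin n → E) (z : Fin n → StrongDual ℝ F),
    ∑ i, |z i (T (x i, e i) - T (y i, e i))| ≤
      C * finLpNorm p (fun i => dist (x i) (y i) * ‖e i‖) * weakLpNorm p.conjExponent z

/-- `(𝒟_p^{LipL}, d_p^{LipL})`: the Cohen strongly `p`-summing Lip-linear operators. -/
def cohenLipL (p : ℝ≥0∞) : LipLClass.{u} where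
  mem := fun X E F _ _ _ _ _ _ => {T | T ∈ LipL0 X E F ∧ ∃ C : ℝ, 0 < C ∧ CohenBound p T C}
  size := fun _ _ _ _ _ _ _ _ _ T => sInf {C : ℝ | 0 < C ∧ CohenBound p T C}

/-- `T = u ∘ S` with a Banach space `G`, `S ∈ LipL₀(X × E; G)` and `u ∈ ℐ(G; F)`, where
`r = ‖u‖_ℐ · LipL(S)`. -/
def FactorsWith (I : OpClass.{u}) {X E F : Type u} [MetricSpace X] [Zero X]
    [NormedAddCommGroup E] [NormedSpace ℝ E] [NormedAddCommGroup F] [NormedSpace ℝ F]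
    (T : X × E → F) (r : ℝ) : Prop :=
  ∃ (G : Type u) (_ : NormedAddCommGroup G) (_ : NormedSpace ℝ G) (_ : CompleteSpace G)
    (S : X × E → G) (u : G →L[ℝ] F),
    S ∈ LipL0 X E G ∧ u ∈ I.mem G F ∧ T = u ∘ S ∧ r = I.size G F u * lipLNorm S

/-- `(ℐ ∘ LipL₀, ‖·‖_{ℐ ∘ LipL₀})`: the class produced from `ℐ` by the composition method. -/
def OpClass.compLipL (I : OpClass.{u}) : LipLClass.{u} where
  mem := fun X E F _ _ _ _ _ _ => {T | T ∈ LipL0 X E F ∧ ∃ r : ℝ, FactorsWith I T r}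
  size := fun _ _ _ _ _ _ _ _ _ T => sInf {r : ℝ | FactorsWith I T r}

/-- Banach Lip-linear ideals. -/
structure IsBanachLipLIdeal (I : LipLClass.{u}) : Prop where
  subset : ∀ (X E F : Type u) [MetricSpace X] [Zero X]
    [NormedAddCommGroup E] [NormedSpace ℝ E] [CompleteSpace E]
    [NormedAddCommGroup F] [NormedSpace ℝ F] [CompleteSpace F], I.mem X E F ⊆ LipL0 X E F
  /-- The components are vector subspaces. -/
  subspace : ∀ (X E F : Type u) [MetricSpace X] [Zero X]
    [NormedAddCommGroup E] [NormedSpace ℝ E] [CompleteSpace E]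
    [NormedAddCommGroup F] [NormedSpace ℝ F] [CompleteSpace F],
    ∃ V : Submodule ℝ (X × E → F), (V : Set (X × E → F)) = I.mem X E F
  rank_one : ∀ (X E F : Type u) [MetricSpace X] [Zero X]
    [NormedAddCommGroup E] [NormedSpace ℝ E] [CompleteSpace E]
    [NormedAddCommGroup F] [NormedSpace ℝ F] [CompleteSpace F]
    (f : X → ℝ) (φ : StrongDual ℝ E) (z : F),
    (∃ C : ℝ, ∀ x y : X, |f x - f y| ≤ C * dist x y) → f 0 = 0 →
      (fun a : X × E => (f a.1 * φ a.2) • z) ∈ I.mem X E F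
  /-- The ideal property and its norm inequality. -/
  ideal : ∀ (X X₀ E E₀ F F₀ : Type u) [MetricSpace X] [Zero X] [MetricSpace X₀] [Zero X₀]
    [NormedAddCommGroup E] [NormedSpace ℝ E] [CompleteSpace E]
    [NormedAddCommGroup E₀] [NormedSpace ℝ E₀] [CompleteSpace E₀]
    [NormedAddCommGroup F] [NormedSpace ℝ F] [CompleteSpace F]
    [NormedAddCommGroup F₀] [NormedSpace ℝ F₀] [CompleteSpace F₀]
    (f : X → X₀) (v : E →L[ℝ] E₀) (T : X₀ × E₀ → F₀) (u : F₀ →L[ℝ] F),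
    f ∈ Lip0 X X₀ → T ∈ I.mem X₀ E₀ F₀ →
      (fun a : X × E => u (T (f a.1, v a.2))) ∈ I.mem X E F ∧
      I.size X E F (fun a : X × E => u (T (f a.1, v a.2))) ≤
        ‖u‖ * I.size X₀ E₀ F₀ T * lipConst f * ‖v‖
  /-- The size function is a norm on each component. -/
  size_nonneg : ∀ (X E F : Type u) [MetricSpace X] [Zero X]
    [NormedAddCommGroup E] [NormedSpace ℝ E] [CompleteSpace E]
    [NormedAddCommGroup F] [NormedSpace ℝ F] [CompleteSpace F],
    ∀ T ∈ I.mem X E F, 0 ≤ I.size X E F T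
  size_eq_zero : ∀ (X E F : Type u) [MetricSpace X] [Zero X]
    [NormedAddCommGroup E] [NormedSpace ℝ E] [CompleteSpace E]
    [NormedAddCommGroup F] [NormedSpace ℝ F] [CompleteSpace F],
    ∀ T ∈ I.mem X E F, I.size X E F T = 0 → T = 0
  size_smul : ∀ (X E F : Type u) [MetricSpace X] [Zero X]
    [NormedAddCommGroup E] [NormedSpace ℝ E] [CompleteSpace E]
    [NormedAddCommGroup F] [NormedSpace ℝ F] [CompleteSpace F],
    ∀ T ∈ I.mem X E F, ∀ c : ℝ, I.size X E F (c • T) = |c| * I.size X E F T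
  size_add : ∀ (X E F : Type u) [MetricSpace X] [Zero X]
    [NormedAddCommGroup E] [NormedSpace ℝ E] [CompleteSpace E]
    [NormedAddCommGroup F] [NormedSpace ℝ F] [CompleteSpace F],
    ∀ T ∈ I.mem X E F, ∀ S ∈ I.mem X E F,
      I.size X E F (T + S) ≤ I.size X E F T + I.size X E F S
  /-- Each component is complete: Cauchy sequences converge. -/
  complete : ∀ (X E F : Type u) [MetricSpace X] [Zero X]
    [NormedAddCommGroup E] [NormedSpace ℝ E] [CompleteSpace E]
    [NormedAddCommGroup F] [NormedSpace ℝ F] [CompleteSpace F]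
    (T : ℕ → X × E → F), (∀ k, T k ∈ I.mem X E F) →
    (∀ ε : ℝ, 0 < ε → ∃ N : ℕ, ∀ k ≥ N, ∀ l ≥ N, I.size X E F (T k - T l) < ε) →
    ∃ S ∈ I.mem X E F, ∀ ε : ℝ, 0 < ε → ∃ N : ℕ, ∀ k ≥ N, I.size X E F (T k - S) < ε
  lipLNorm_le : ∀ (X E F : Type u) [MetricSpace X] [Zero X]
    [NormedAddCommGroup E] [NormedSpace ℝ E] [CompleteSpace E]
    [NormedAddCommGroup F] [NormedSpace ℝ F] [CompleteSpace F],
    ∀ T ∈ I.mem X E F, lipLNorm T ≤ I.size X E F T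
  /-- The multiplication `ℝ × ℝ → ℝ` has norm one (`ULift ℝ` is the copy of `ℝ` in the ambient
  universe). -/
  size_mul : I.size (ULift.{u} ℝ) (ULift.{u} ℝ) (ULift.{u} ℝ)
    (fun a => ULift.up (a.1.down * a.2.down)) = 1

end

end CohenLip

namespace CohenLip

noncomputable section

/-! ### Finite `ℓ_p` norms -/

/-! The ideal axioms follow from finite inequalities. Admissible constants form a closed upper set,
so each infimum is itself admissible (`IsClosedUpper.sInf_mem`) and norm estimates reduce to
estimates with explicit constants. A Cohen bound tested on a single term controls the Lip-linear
norm. Cohen bounds also survive pointwise limits, which gives completeness, and Hölder's inequality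
puts rank-one maps in the class.

If `T = u ∘ S`, the inequality for `u` applied to the vectors `S (x i, e i) - S (y i, e i)` gives
the Cohen bound for `T` with the product of the two constants.

For the converse, let `U` map the unit vectors of `ℓ₁(X × X × E)` to the difference quotients of
`T`, normalized by `dist x y * ‖e‖`, and let `G` be the quotient of `ℓ₁` by the kernel of `U`. The
induced map `u : G → F` is injective, so linearity and increments of `S` can be checked after
applying `u`; this yields `T = u ∘ S` with Lip-linear constant 1 for `S` (`exists_factorization`).
Moreover `|z (u g)|` is at most `‖g‖` times the supremum of `|z|` over the difference quotients.
Choosing nearly optimal quotients for each `z i` and rescaling the vectors `e i` turns the Cohen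
inequality for `T` into the summing inequality for `u`, with the same constant
(`CohenBound.sum_mul_iSup_le`). Hence the norms agree exactly. -/

theorem one_le_conjExponent (p : ℝ≥0∞) : 1 ≤ p.conjExponent := le_self_add

theorem finLpNorm_nonneg (p : ℝ≥0∞) [Fact (1 ≤ p)] {n : ℕ} (a : Fin n → ℝ) :
    0 ≤ finLpNorm p a :=
  norm_nonneg (WithLp.toLp p a)

theorem finLpNorm_top {n : ℕ} (a : Fin n → ℝ) : finLpNorm ∞ a = ⨆ i, |a i| := by
  rw [finLpNorm, PiLp.norm_eq_ciSup]
  rfl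

theorem finLpNorm_eq_sum {p : ℝ≥0∞} (hp : 0 < p.toReal) {n : ℕ} (a : Fin n → ℝ) :
    finLpNorm p a = (∑ i, |a i| ^ p.toReal) ^ (1 / p.toReal) := by
  rw [finLpNorm, PiLp.norm_eq_sum hp]
  rfl

theorem toReal_pos_of_one_le {p : ℝ≥0∞} (hp : 1 ≤ p) (htop : p ≠ ∞) : 0 < p.toReal :=
  ENNReal.toReal_pos (zero_lt_one.trans_le hp).ne' htop

theorem finLpNorm_mono (p : ℝ≥0∞) [hp : Fact (1 ≤ p)] {n : ℕ} {a b : Fin n → ℝ}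
    (h : ∀ i, |a i| ≤ b i) : finLpNorm p a ≤ finLpNorm p b := by
  have h' : ∀ i, |a i| ≤ |b i| := fun i => (h i).trans (le_abs_self _)
  rcases eq_or_ne p ∞ with rfl | htop
  · rw [finLpNorm_top, finLpNorm_top]
    -- For `n = 0` both suprema are 0, which is why the bound must be known to be nonnegative.
    exact Real.iSup_le (fun i => (h' i).trans (le_ciSup (Set.finite_range fun i => |b i|).bddAbove i))
      (Real.iSup_nonneg fun i => abs_nonneg _)
  · have hpos := toReal_pos_of_one_le hp.out htop
    rw [finLpNorm_eq_sum hpos, finLpNorm_eq_sum hpos]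
    exact Real.rpow_le_rpow (Finset.sum_nonneg fun i _ => by positivity)
      (Finset.sum_le_sum fun i _ => Real.rpow_le_rpow (abs_nonneg _) (h' i) hpos.le) (by positivity)

theorem finLpNorm_const_mul (p : ℝ≥0∞) [Fact (1 ≤ p)] {n : ℕ} (c : ℝ) (a : Fin n → ℝ) :
    finLpNorm p (fun i => c * a i) = |c| * finLpNorm p a :=
  norm_smul c (WithLp.toLp p a)

theorem finLpNorm_fin_one (p : ℝ≥0∞) [hp : Fact (1 ≤ p)] (a : Fin 1 → ℝ) :
    finLpNorm p a = |a 0| := by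
  rcases eq_or_ne p ∞ with rfl | htop
  · rw [finLpNorm_top, ciSup_unique]
    rfl
  · have hpos := toReal_pos_of_one_le hp.out htop
    rw [finLpNorm_eq_sum hpos, Fin.sum_univ_one, one_div, Real.rpow_rpow_inv (abs_nonneg _) hpos.ne']

/-- Hölder's inequality. -/
theorem sum_abs_mul_le_finLpNorm (p : ℝ≥0∞) (hp : 1 < p) {n : ℕ} (a b : Fin n → ℝ) :
    ∑ i, |a i * b i| ≤ finLpNorm p a * finLpNorm p.conjExponent b := by
  rcases eq_or_ne p ∞ with rfl | htop
  · have hq : (∞ : ℝ≥0∞).conjExponent = 1 := by simp [ENNReal.conjExponent]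
    rw [hq, finLpNorm_top, finLpNorm_eq_sum (by simp)]
    simp only [ENNReal.toReal_one, Real.rpow_one, div_one, abs_mul, Finset.mul_sum]
    gcongr with i
    exact le_ciSup (Set.finite_range fun i => |a i|).bddAbove i
  · lift p to NNReal using htop
    have hp' : 1 < p := by exact_mod_cast hp
    have hpq := NNReal.HolderConjugate.conjExponent hp'
    rw [← ENNReal.coe_conjExponent hp',
      finLpNorm_eq_sum (by simpa using hpq.pos), finLpNorm_eq_sum (by simpa using hpq.symm.pos)]
    simpa [abs_mul] using
      Real.inner_le_Lp_mul_Lq Finset.univ (fun i => |a i|) (fun i => |b i|)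
        (NNReal.holderConjugate_coe_iff.2 hpq)

/-! ### Weak `ℓ_q` norms -/

section Weak

variable {E F : Type u} [NormedAddCommGroup E] [NormedSpace ℝ E] [NormedAddCommGroup F]
  [NormedSpace ℝ F] (q : ℝ≥0∞) {n : ℕ}

theorem weakLpNorm_le {z : Fin n → E} {B : ℝ}
    (h : ∀ φ : StrongDual ℝ E, ‖φ‖ ≤ 1 → finLpNorm q (fun i => φ (z i)) ≤ B) :
    weakLpNorm q z ≤ B := by
  have : Nonempty (Metric.closedBall (0 : StrongDual ℝ E) 1) :=
    ⟨⟨0, Metric.mem_closedBall_self zero_le_one⟩⟩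
  exact ciSup_le fun φ => h φ (mem_closedBall_zero_iff.1 φ.2)

variable [Fact (1 ≤ q)]

theorem weakLpNorm_nonneg (z : Fin n → E) : 0 ≤ weakLpNorm q z :=
  Real.iSup_nonneg fun _ => finLpNorm_nonneg q _

theorem finLpNorm_apply_le_of_norm_le_one (φ : StrongDual ℝ E) (hφ : ‖φ‖ ≤ 1) (z : Fin n → E) :
    finLpNorm q (fun i => φ (z i)) ≤ weakLpNorm q z := by
  -- The family of norms `‖z i‖` dominates every test functional in the ball, so the supremum is
  -- finite.
  refine le_ciSup (f := fun φ : Metric.closedBall (0 : StrongDual ℝ E) 1 =>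
    finLpNorm q (fun i => (φ : StrongDual ℝ E) (z i))) ⟨finLpNorm q fun i => ‖z i‖, ?_⟩
    ⟨φ, mem_closedBall_zero_iff.2 hφ⟩
  rintro _ ⟨ψ, rfl⟩
  refine finLpNorm_mono q fun i => ?_
  simpa using ψ.1.le_of_opNorm_le (mem_closedBall_zero_iff.1 ψ.2) (z i)

theorem finLpNorm_apply_le (φ : StrongDual ℝ E) (z : Fin n → E) :
    finLpNorm q (fun i => φ (z i)) ≤ ‖φ‖ * weakLpNorm q z := by
  rcases eq_or_ne φ 0 with rfl | hφ
  · have h := finLpNorm_const_mul q 0 (0 : Fin n → ℝ)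
    simp at h ⊢
    exact h.le
  · have hφ' : 0 < ‖φ‖ := norm_pos_iff.2 hφ
    have h := finLpNorm_apply_le_of_norm_le_one q (‖φ‖⁻¹ • φ)
      (by rw [norm_smul, norm_inv, norm_norm, inv_mul_cancel₀ hφ'.ne']) z
    simp only [smul_apply, smul_eq_mul] at h
    rwa [finLpNorm_const_mul, abs_of_pos (inv_pos.2 hφ'), inv_mul_le_iff₀ hφ'] at h

theorem weakLpNorm_map_le (w : E →L[ℝ] F) (z : Fin n → E) :
    weakLpNorm q (fun i => w (z i)) ≤ ‖w‖ * weakLpNorm q z := by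
  refine weakLpNorm_le q fun φ hφ => (finLpNorm_apply_le q (φ.comp w) z).trans ?_
  gcongr
  · exact weakLpNorm_nonneg q z
  · exact (φ.opNorm_comp_le w).trans (mul_le_of_le_one_left (norm_nonneg _) hφ)

theorem weakLpNorm_fin_one_le (z : Fin 1 → E) : weakLpNorm q z ≤ ‖z 0‖ := by
  refine weakLpNorm_le q fun φ hφ => ?_
  rw [finLpNorm_fin_one]
  simpa using φ.le_of_opNorm_le hφ (z 0)

/-- Precomposition with `w` is the adjoint of `w`, whose norm is at most `‖w‖`. -/
theorem weakLpNorm_precomp_le (w : E →L[ℝ] F) (z : Fin n → StrongDual ℝ F) :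
    weakLpNorm q (fun i => (z i).comp w) ≤ ‖w‖ * weakLpNorm q z := by
  refine (weakLpNorm_map_le q ((ContinuousLinearMap.compL ℝ E F ℝ).flip w) z).trans ?_
  gcongr
  · exact weakLpNorm_nonneg q z
  · refine ContinuousLinearMap.opNorm_le_bound _ (norm_nonneg _) fun φ => ?_
    simpa [mul_comm] using φ.opNorm_comp_le w

/-- The weak norm of functionals is a supremum over the bidual ball, and evaluation at `f` is an
element of the bidual of norm at most `‖f‖`. -/
theorem finLpNorm_eval_le (z : Fin n → StrongDual ℝ F) (f : F) :
    finLpNorm q (fun i => z i f) ≤ ‖f‖ * weakLpNorm q z := by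
  refine (finLpNorm_apply_le q (NormedSpace.inclusionInDoubleDual ℝ F f) z).trans ?_
  gcongr
  · exact weakLpNorm_nonneg q z
  · exact NormedSpace.double_dual_bound ℝ F f

end Weak

/-! ### Least constants -/

theorem le_mul_of_forall_pos_le_add_mul {a b C : ℝ} (h : ∀ ε : ℝ, 0 < ε → a ≤ (C + ε) * b) :
    a ≤ C * b := by
  refine le_of_forall_pos_le_add fun δ hδ => ?_
  have hb : 0 < |b| + 1 := by positivity
  -- The sign of `b` is unrestricted; adding 1 keeps the denominator positive when `b = 0`.
  refine (h (δ / (|b| + 1)) (by positivity)).trans ?_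
  rw [add_mul, div_mul_eq_mul_div]
  gcongr
  rw [div_le_iff₀ hb]
  gcongr
  exact (le_abs_self b).trans (le_add_of_nonneg_right zero_le_one)

/-- The set of constants `C` with `P C` is a closed upper set. -/
structure IsClosedUpper (P : ℝ → Prop) : Prop where
  mono : ∀ {C D : ℝ}, C ≤ D → P C → P D
  closed : ∀ {C : ℝ}, (∀ ε : ℝ, 0 < ε → P (C + ε)) → P C

theorem bddBelow_pos_and (P : ℝ → Prop) : BddBelow {C : ℝ | 0 < C ∧ P C} :=
  ⟨0, fun _ hC => hC.1.le⟩

theorem sInf_pos_and_nonneg (P : ℝ → Prop) : 0 ≤ sInf {C : ℝ | 0 < C ∧ P C} :=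
  Real.sInf_nonneg fun _ hC => hC.1.le

theorem IsClosedUpper.sInf_mem {P : ℝ → Prop} (h : IsClosedUpper P) (hne : ∃ C : ℝ, 0 < C ∧ P C) :
    P (sInf {C : ℝ | 0 < C ∧ P C}) := by
  refine h.closed fun ε hε => ?_
  obtain ⟨C, hC, hlt⟩ := exists_lt_of_csInf_lt hne (lt_add_of_pos_right _ hε)
  exact h.mono hlt.le hC.2

/-- The defining set contains only positive constants, so the case `C = 0` is reached through `C +
ε`. -/
theorem IsClosedUpper.sInf_le {P : ℝ → Prop} (h : IsClosedUpper P) {C : ℝ} (hC : 0 ≤ C)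
    (hP : P C) : sInf {C : ℝ | 0 < C ∧ P C} ≤ C :=
  le_of_forall_pos_le_add fun ε hε => csInf_le (bddBelow_pos_and P)
    ⟨by positivity, h.mono (le_add_of_nonneg_right hε.le) hP⟩

theorem IsClosedUpper.exists_pos {P : ℝ → Prop} (h : IsClosedUpper P) {C : ℝ} (hP : P C) :
    ∃ D : ℝ, 0 < D ∧ P D :=
  ⟨|C| + 1, by positivity, h.mono ((le_abs_self C).trans (le_add_of_nonneg_right zero_le_one)) hP⟩

theorem isClosedUpper_lipLBound {X E F : Type u} [MetricSpace X] [NormedAddCommGroup E]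
    [NormedAddCommGroup F] (T : X × E → F) : IsClosedUpper (LipLBound T) where
  mono hCD h x y e := (h x y e).trans (by gcongr)
  closed h x y e := by
    rw [mul_assoc]
    exact le_mul_of_forall_pos_le_add_mul fun ε hε => by simpa only [mul_assoc] using h ε hε x y e

theorem isClosedUpper_stronglySummingBound {E F : Type u} [NormedAddCommGroup E] [NormedSpace ℝ E]
    [NormedAddCommGroup F] [NormedSpace ℝ F] (p : ℝ≥0∞) [Fact (1 ≤ p)] (u : E →L[ℝ] F) :
    IsClosedUpper (StronglySummingBound p u) where
  mono hCD h n x z := by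
    have : Fact (1 ≤ p.conjExponent) := ⟨one_le_conjExponent p⟩
    refine (h n x z).trans ?_
    gcongr
    · exact weakLpNorm_nonneg _ z
    · exact finLpNorm_nonneg p _
  closed h n x z := by
    rw [mul_assoc]
    exact le_mul_of_forall_pos_le_add_mul fun ε hε => by simpa only [mul_assoc] using h ε hε n x z

theorem isClosedUpper_cohenBound {X E F : Type u} [MetricSpace X] [NormedAddCommGroup E]
    [NormedAddCommGroup F] [NormedSpace ℝ F] (p : ℝ≥0∞) [Fact (1 ≤ p)] (T : X × E → F) :
    IsClosedUpper (CohenBound p T) where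
  mono hCD h n x y e z := by
    have : Fact (1 ≤ p.conjExponent) := ⟨one_le_conjExponent p⟩
    refine (h n x y e z).trans ?_
    gcongr
    · exact weakLpNorm_nonneg _ z
    · exact finLpNorm_nonneg p _
  closed h n x y e z := by
    rw [mul_assoc]
    exact le_mul_of_forall_pos_le_add_mul fun ε hε => by
      simpa only [mul_assoc] using h ε hε n x y e z

theorem dist_le_lipConst_mul {X Y : Type u} [MetricSpace X] [MetricSpace Y] {f : X → Y}
    (hf : ∃ C : ℝ, ∀ x y : X, dist (f x) (f y) ≤ C * dist x y) (x y : X) :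
    dist (f x) (f y) ≤ lipConst f * dist x y := by
  obtain ⟨C, hC⟩ := hf
  rcases eq_or_ne x y with rfl | hxy
  · simp
  · rw [← div_le_iff₀ (dist_pos.2 hxy)]
    refine le_csSup ⟨C, ?_⟩ ⟨x, y, hxy, rfl⟩
    rintro _ ⟨x, y, hxy, rfl⟩
    rw [div_le_iff₀ (dist_pos.2 hxy)]
    exact hC x y

theorem lipConst_nonneg {X Y : Type u} [MetricSpace X] [MetricSpace Y] (f : X → Y) :
    0 ≤ lipConst f := by
  refine Real.sSup_nonneg ?_
  rintro _ ⟨x, y, -, rfl⟩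
  positivity

/-! ### The ideal properties -/

section Bounds

variable {X E F : Type u} [MetricSpace X] [NormedAddCommGroup E] [NormedAddCommGroup F]
  [NormedSpace ℝ F] {p : ℝ≥0∞} {T S : X × E → F} {C D : ℝ}

theorem CohenBound.add (hT : CohenBound p T C) (hS : CohenBound p S D) :
    CohenBound p (T + S) (C + D) := fun n x y e z => by
  rw [add_mul, add_mul]
  refine le_trans ?_ (add_le_add (hT n x y e z) (hS n x y e z))
  rw [← Finset.sum_add_distrib]
  gcongr with i
  rw [Pi.add_apply, Pi.add_apply, add_sub_add_comm, map_add]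
  exact abs_add_le _ _

theorem CohenBound.smul (hT : CohenBound p T C) (c : ℝ) :
    CohenBound p (c • T) (|c| * C) := fun n x y e z => by
  have h : ∀ i, |z i ((c • T) (x i, e i) - (c • T) (y i, e i))| =
      |c| * |z i (T (x i, e i) - T (y i, e i))| := fun i => by
    rw [Pi.smul_apply, Pi.smul_apply, ← smul_sub, map_smul, smul_eq_mul, abs_mul]
  simp only [h]
  rw [← Finset.mul_sum, mul_assoc, mul_assoc, ← mul_assoc C]
  exact mul_le_mul_of_nonneg_left (hT n x y e z) (abs_nonneg c)

theorem cohenBound_zero : CohenBound p (0 : X × E → F) 0 := fun n x y e z => by simp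

/-- One term suffices, tested against a norming functional supplied by Hahn–Banach. -/
theorem CohenBound.lipLBound [Fact (1 ≤ p)] (hC : 0 ≤ C) (hT : CohenBound p T C) : LipLBound T C :=
    fun x y e => by
  have : Fact (1 ≤ p.conjExponent) := ⟨one_le_conjExponent p⟩
  obtain ⟨z, hz, hzT⟩ := exists_dual_vector'' ℝ (T (x, e) - T (y, e))
  have h := hT 1 (fun _ => x) (fun _ => y) (fun _ => e) (fun _ => z)
  rw [Fin.sum_univ_one, hzT, finLpNorm_fin_one] at h
  calc ‖T (x, e) - T (y, e)‖ ≤ |(‖T (x, e) - T (y, e)‖ : ℝ)| := le_abs_self _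
    _ ≤ C * |dist x y * ‖e‖| * weakLpNorm p.conjExponent (fun _ : Fin 1 => z) := h
    _ ≤ C * |dist x y * ‖e‖| * 1 := by
      gcongr
      exact (weakLpNorm_fin_one_le _ _).trans hz
    _ = C * dist x y * ‖e‖ := by rw [mul_one, abs_of_nonneg (by positivity), mul_assoc]

/-- Each instance of the inequality involves finitely many values of the map, so pointwise
convergence is enough. -/
theorem CohenBound.of_tendsto {T : ℕ → X × E → F}
    (hT : ∀ a, Filter.Tendsto (fun k => T k a) Filter.atTop (nhds (S a)))
    (h : ∀ᶠ k in Filter.atTop, CohenBound p (T k) C) : CohenBound p S C := fun n x y e z => by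
  refine le_of_tendsto (tendsto_finsetSum _ fun i _ => ?_) (h.mono fun k hk => hk n x y e z)
  exact (((z i).continuous.tendsto _).comp ((hT _).sub (hT _))).abs

end Bounds

/-- Each term splits as a scalar increment times `z i w`; Hölder separates the two families. -/
theorem cohenBound_rank_one {X E F : Type u} [MetricSpace X] [NormedAddCommGroup E]
    [NormedSpace ℝ E] [NormedAddCommGroup F] [NormedSpace ℝ F] {p : ℝ≥0∞} (hp : 1 < p)
    {f : X → ℝ} {C : ℝ} (hC : 0 ≤ C) (hf : ∀ x y, |f x - f y| ≤ C * dist x y)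
    (φ : StrongDual ℝ E) (w : F) :
    CohenBound p (fun a : X × E => (f a.1 * φ a.2) • w) (C * ‖φ‖ * ‖w‖) := fun n x y e z => by
  have : Fact (1 ≤ p) := ⟨hp.le⟩
  have : Fact (1 ≤ p.conjExponent) := ⟨one_le_conjExponent p⟩
  have hterm : ∀ i, z i ((f (x i) * φ (e i)) • w - (f (y i) * φ (e i)) • w) =
      ((f (x i) - f (y i)) * φ (e i)) * z i w := fun i => by
    rw [← sub_smul, map_smul, smul_eq_mul]
    ring
  simp only [hterm]
  refine (sum_abs_mul_le_finLpNorm p hp _ _).trans ?_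
  have h1 : finLpNorm p (fun i => (f (x i) - f (y i)) * φ (e i)) ≤
      C * ‖φ‖ * finLpNorm p (fun i => dist (x i) (y i) * ‖e i‖) := by
    rw [← abs_of_nonneg (by positivity : 0 ≤ C * ‖φ‖), ← finLpNorm_const_mul]
    refine finLpNorm_mono p fun i => ?_
    rw [abs_mul]
    calc _ ≤ (C * dist (x i) (y i)) * (‖φ‖ * ‖e i‖) :=
          mul_le_mul (hf _ _) (φ.le_opNorm _) (abs_nonneg _) (by positivity)
      _ = _ := by ring
  calc _ ≤ (C * ‖φ‖ * finLpNorm p (fun i => dist (x i) (y i) * ‖e i‖)) *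
        (‖w‖ * weakLpNorm p.conjExponent z) :=
        mul_le_mul h1 (finLpNorm_eval_le _ z w) (finLpNorm_nonneg _ _)
          (mul_nonneg (by positivity) (finLpNorm_nonneg _ _))
    _ = _ := by ring

theorem CohenBound.comp {X X₀ E E₀ F F₀ : Type u} [MetricSpace X] [MetricSpace X₀]
    [NormedAddCommGroup E] [NormedSpace ℝ E] [NormedAddCommGroup E₀] [NormedSpace ℝ E₀]
    [NormedAddCommGroup F] [NormedSpace ℝ F] [NormedAddCommGroup F₀] [NormedSpace ℝ F₀]
    {p : ℝ≥0∞} [Fact (1 ≤ p)] {f : X → X₀} {L : ℝ} (hL : 0 ≤ L)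
    (hf : ∀ x y, dist (f x) (f y) ≤ L * dist x y) (v : E →L[ℝ] E₀) {T : X₀ × E₀ → F₀} {C : ℝ}
    (hC : 0 ≤ C) (hT : CohenBound p T C) (u : F₀ →L[ℝ] F) :
    CohenBound p (fun a : X × E => u (T (f a.1, v a.2))) (‖u‖ * C * L * ‖v‖) :=
    fun n x y e z => by
  have : Fact (1 ≤ p.conjExponent) := ⟨one_le_conjExponent p⟩
  have h := hT n (fun i => f (x i)) (fun i => f (y i)) (fun i => v (e i)) (fun i => (z i).comp u)
  have h1 : finLpNorm p (fun i => dist (f (x i)) (f (y i)) * ‖v (e i)‖) ≤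
      L * ‖v‖ * finLpNorm p (fun i => dist (x i) (y i) * ‖e i‖) := by
    rw [← abs_of_nonneg (by positivity : 0 ≤ L * ‖v‖), ← finLpNorm_const_mul]
    refine finLpNorm_mono p fun i => ?_
    rw [abs_of_nonneg (by positivity)]
    calc _ ≤ (L * dist (x i) (y i)) * (‖v‖ * ‖e i‖) :=
          mul_le_mul (hf _ _) (v.le_opNorm _) (norm_nonneg _) (by positivity)
      _ = _ := by ring
  simp only [ContinuousLinearMap.comp_apply, map_sub] at h ⊢
  calc _ ≤ _ := h
    _ ≤ C * (L * ‖v‖ * finLpNorm p (fun i => dist (x i) (y i) * ‖e i‖)) *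
        (‖u‖ * weakLpNorm p.conjExponent z) :=
        mul_le_mul (mul_le_mul_of_nonneg_left h1 hC) (weakLpNorm_precomp_le _ u z)
          (weakLpNorm_nonneg _ _)
          (mul_nonneg hC (mul_nonneg (by positivity) (finLpNorm_nonneg _ _)))
    _ = _ := by ring

/-! ### Components as complete normed spaces. -/

section Components

variable {X E F : Type u} [MetricSpace X] [Zero X] [NormedAddCommGroup E] [NormedSpace ℝ E]
  [NormedAddCommGroup F] [NormedSpace ℝ F] {p : ℝ≥0∞} [Fact (1 ≤ p)] {T S : X × E → F} {C : ℝ}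

theorem CohenBound.mem (hT : CohenBound p T C) (hlin : ∀ x, IsLinearMap ℝ fun e : E => T (x, e))
    (hzero : ∀ e : E, T (0, e) = 0) : T ∈ (cohenLipL.{u} p).mem X E F := by
  obtain ⟨D, hD, hTD⟩ := (isClosedUpper_cohenBound p T).exists_pos hT
  exact ⟨⟨hlin, ⟨D, hD, hTD.lipLBound hD.le⟩, hzero⟩, D, hD, hTD⟩

theorem CohenBound.size_le (hC : 0 ≤ C) (hT : CohenBound p T C) :
    (cohenLipL.{u} p).size X E F T ≤ C :=
  (isClosedUpper_cohenBound p T).sInf_le hC hT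

theorem cohenBound_size (hT : T ∈ (cohenLipL.{u} p).mem X E F) :
    CohenBound p T ((cohenLipL.{u} p).size X E F T) :=
  (isClosedUpper_cohenBound p T).sInf_mem hT.2

theorem size_cohenLipL_nonneg (p : ℝ≥0∞) (T : X × E → F) :
    0 ≤ (cohenLipL.{u} p).size X E F T :=
  sInf_pos_and_nonneg _

theorem lipLBound_size (hT : T ∈ (cohenLipL.{u} p).mem X E F) :
    LipLBound T ((cohenLipL.{u} p).size X E F T) :=
  (cohenBound_size hT).lipLBound (size_cohenLipL_nonneg p T)

variable (X E F p) in
/-- A component of `𝒟_p^{LipL}` as a vector space. -/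
def cohenSubmodule : Submodule ℝ (X × E → F) where
  carrier := (cohenLipL.{u} p).mem X E F
  zero_mem' := cohenBound_zero.mem (fun _ => ⟨fun _ _ => (add_zero 0).symm,
    fun c _ => (smul_zero c).symm⟩) fun _ => rfl
  add_mem' {T S} hT hS := ((cohenBound_size hT).add (cohenBound_size hS)).mem
    (fun x => ((hT.1.1 x).mk' _ + (hS.1.1 x).mk' _).isLinear) fun e => by
      rw [Pi.add_apply, hT.1.2.2, hS.1.2.2, add_zero]
  smul_mem' c T hT := ((cohenBound_size hT).smul c).mem
    (fun x => (c • (hT.1.1 x).mk' _).isLinear) fun e => by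
      rw [Pi.smul_apply, hT.1.2.2, smul_zero]

theorem size_cohenLipL_smul_le (hT : T ∈ (cohenLipL.{u} p).mem X E F) (c : ℝ) :
    (cohenLipL.{u} p).size X E F (c • T) ≤ |c| * (cohenLipL.{u} p).size X E F T :=
  ((cohenBound_size hT).smul c).size_le (mul_nonneg (abs_nonneg c) (size_cohenLipL_nonneg p T))

theorem size_cohenLipL_smul (hT : T ∈ (cohenLipL.{u} p).mem X E F) (c : ℝ) :
    (cohenLipL.{u} p).size X E F (c • T) = |c| * (cohenLipL.{u} p).size X E F T := by
  refine le_antisymm (size_cohenLipL_smul_le hT c) ?_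
  rcases eq_or_ne c 0 with rfl | hc
  · simpa using size_cohenLipL_nonneg p _
  -- The reverse inequality is the direct one for `c • T` and the scalar `c⁻¹`.
  · have h := size_cohenLipL_smul_le ((cohenSubmodule X E F p).smul_mem c hT) c⁻¹
    rwa [inv_smul_smul₀ hc, abs_inv, le_inv_mul_iff₀ (abs_pos.2 hc)] at h

theorem eq_zero_of_size_cohenLipL_eq_zero (hT : T ∈ (cohenLipL.{u} p).mem X E F)
    (h : (cohenLipL.{u} p).size X E F T = 0) : T = 0 := by
  funext ⟨x, e⟩
  simpa [h, hT.1.2.2] using lipLBound_size hT x 0 e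

theorem exists_limit_cohenLipL [CompleteSpace F] {T : ℕ → X × E → F}
    (hT : ∀ k, T k ∈ (cohenLipL.{u} p).mem X E F)
    (hcau : ∀ ε : ℝ, 0 < ε → ∃ N : ℕ, ∀ k ≥ N, ∀ l ≥ N,
      (cohenLipL.{u} p).size X E F (T k - T l) < ε) :
    ∃ S ∈ (cohenLipL.{u} p).mem X E F, ∀ ε : ℝ, 0 < ε → ∃ N : ℕ, ∀ k ≥ N,
      (cohenLipL.{u} p).size X E F (T k - S) < ε := by
  have hsub : ∀ k l, T k - T l ∈ (cohenLipL.{u} p).mem X E F := fun k l =>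
    (cohenSubmodule X E F p).sub_mem (hT k) (hT l)
  have hpt : ∀ a, CauchySeq fun k => T k a := fun ⟨x, e⟩ => by
    refine Metric.cauchySeq_iff.2 fun ε hε => ?_
    have hb : 0 < dist x 0 * ‖e‖ + 1 := by positivity
    obtain ⟨N, hN⟩ := hcau (ε / (dist x 0 * ‖e‖ + 1)) (by positivity)
    refine ⟨N, fun k hk l hl => ?_⟩
    have h := lipLBound_size (hsub k l) x 0 e
    rw [(hsub k l).1.2.2, sub_zero, mul_assoc] at h
    rw [dist_eq_norm]
    calc ‖T k (x, e) - T l (x, e)‖ ≤ _ := h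
      _ ≤ ε / (dist x 0 * ‖e‖ + 1) * (dist x 0 * ‖e‖) := by
        gcongr
        exact (hN k hk l hl).le
      _ < ε := by
        rw [div_mul_eq_mul_div, div_lt_iff₀ hb]
        gcongr
        exact lt_add_one _
  choose S hS using fun a => cauchySeq_tendsto_of_complete (hpt a)
  have hlim : ∀ ε : ℝ, 0 < ε → ∃ N : ℕ, ∀ k ≥ N, CohenBound p (T k - S) ε := fun ε hε => by
    obtain ⟨N, hN⟩ := hcau ε hε
    -- With `k` fixed, `l` tends to infinity in the bound for `T k - T l`.
    refine ⟨N, fun k hk => CohenBound.of_tendsto (T := fun l => T k - T l)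
      (fun a => tendsto_const_nhds.sub (hS a)) (Filter.eventually_atTop.2 ⟨N, fun l hl => ?_⟩)⟩
    exact (isClosedUpper_cohenBound p _).mono (hN k hk l hl).le (cohenBound_size (hsub k l))
  refine ⟨S, ?_, fun ε hε => ?_⟩
  · obtain ⟨N, hN⟩ := hlim 1 one_pos
    -- The limit is recovered as `S = T N - (T N - S)`, a difference of maps with Cohen bounds.
    have h := (cohenBound_size (hT N)).add ((hN N le_rfl).smul (-1))
    rw [neg_one_smul, ← sub_eq_add_neg, sub_sub_cancel] at h
    refine h.mem (fun x => ⟨fun e e' => ?_, fun c e => ?_⟩) fun e => ?_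
    · refine tendsto_nhds_unique (hS (x, e + e')) (((hS (x, e)).add (hS (x, e'))).congr fun k => ?_)
      exact ((hT k).1.1 x).map_add e e' |>.symm
    · refine tendsto_nhds_unique (hS (x, c • e)) (((hS (x, e)).const_smul c).congr fun k => ?_)
      exact ((hT k).1.1 x).map_smul c e |>.symm
    · refine tendsto_nhds_unique (hS (0, e)) (tendsto_const_nhds.congr fun k => ?_)
      exact ((hT k).1.2.2 e).symm
  · obtain ⟨N, hN⟩ := hlim (ε / 2) (half_pos hε)
    exact ⟨N, fun k hk => ((hN k hk).size_le (half_pos hε).le).trans_lt (half_lt_self hε)⟩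

end Components

/-! ### Rank-one maps, normalization and the ideal axioms. -/

theorem mem_cohenLipL_rank_one {X E F : Type u} [MetricSpace X] [Zero X] [NormedAddCommGroup E]
    [NormedSpace ℝ E] [NormedAddCommGroup F] [NormedSpace ℝ F] {p : ℝ≥0∞} (hp : 1 < p)
    {f : X → ℝ} (hf : ∃ C : ℝ, ∀ x y, |f x - f y| ≤ C * dist x y) (hf0 : f 0 = 0)
    (φ : StrongDual ℝ E) (w : F) :
    (fun a : X × E => (f a.1 * φ a.2) • w) ∈ (cohenLipL.{u} p).mem X E F := by
  have : Fact (1 ≤ p) := ⟨hp.le⟩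
  obtain ⟨C, hC⟩ := hf
  have hC' : ∀ x y, |f x - f y| ≤ |C| * dist x y := fun x y =>
    (hC x y).trans (by gcongr; exact le_abs_self C)
  refine (cohenBound_rank_one hp (abs_nonneg C) hC' φ w).mem (fun x => ⟨?_, ?_⟩) fun e => ?_
  · intro e e'
    simp only [map_add, mul_add, add_smul]
  · intro c e
    simp only [map_smul, smul_eq_mul, mul_smul, smul_comm c]
  · simp only [hf0, zero_mul, zero_smul]

theorem size_cohenLipL_mul {p : ℝ≥0∞} (hp : 1 < p) :
    (cohenLipL.{u} p).size (ULift.{u} ℝ) (ULift.{u} ℝ) (ULift.{u} ℝ)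
      (fun a => ULift.up (a.1.down * a.2.down)) = 1 := by
  have : Fact (1 ≤ p) := ⟨hp.le⟩
  let φ : StrongDual ℝ (ULift.{u} ℝ) := (ContinuousLinearEquiv.ulift : ULift.{u} ℝ ≃L[ℝ] ℝ)
  have hφ : ‖φ‖ ≤ 1 := ContinuousLinearMap.opNorm_le_bound _ zero_le_one fun x => by
    rw [one_mul]
    exact le_rfl
  have heq : (fun a : ULift.{u} ℝ × ULift.{u} ℝ => ULift.up.{u} (a.1.down * a.2.down)) =
      fun a => (a.1.down * φ a.2) • ULift.up.{u} (1 : ℝ) := by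
    funext a
    exact congrArg ULift.up (mul_one _).symm
  have hf : ∀ x y : ULift.{u} ℝ, |x.down - y.down| ≤ 1 * dist x y := fun x y => by
    rw [one_mul]
    exact le_rfl
  have hmem := mem_cohenLipL_rank_one hp ⟨1, hf⟩ rfl φ (ULift.up.{u} (1 : ℝ))
  have hbd := cohenBound_rank_one hp zero_le_one hf φ (ULift.up.{u} (1 : ℝ))
  rw [← heq] at hmem hbd
  refine le_antisymm ?_ ?_
  · refine (hbd.size_le (by positivity)).trans ?_
    simpa using hφ
  -- The increment between the points 1 and 0 at the vector 1 has norm 1, which forces every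
  -- constant to be at least 1.
  · have h := lipLBound_size hmem (ULift.up 1) (ULift.up 0) (ULift.up 1)
    have hd : dist (ULift.up.{u} (1 : ℝ)) (ULift.up 0) = 1 := by
      change dist (1 : ℝ) 0 = 1
      simp
    have hn : ‖ULift.up.{u} ((1 : ℝ) * 1) - ULift.up ((0 : ℝ) * 1)‖ = 1 := by
      change ‖(1 : ℝ) * 1 - 0 * 1‖ = 1
      simp
    rw [hn, hd, ULift.norm_up, norm_one, mul_one, mul_one] at h
    exact h

theorem isBanachLipLIdeal_cohenLipL (p : ℝ≥0∞) (hp : 1 < p) :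
    IsBanachLipLIdeal (cohenLipL.{u} p) := by
  have : Fact (1 ≤ p) := ⟨hp.le⟩
  refine
    { subset := fun X E F _ _ _ _ _ _ _ _ T hT => hT.1
      subspace := fun X E F _ _ _ _ _ _ _ _ => ⟨cohenSubmodule X E F p, rfl⟩
      rank_one := fun X E F _ _ _ _ _ _ _ _ f φ z hf hf0 => mem_cohenLipL_rank_one hp hf hf0 φ z
      ideal := ?_
      size_nonneg := fun X E F _ _ _ _ _ _ _ _ T _ => size_cohenLipL_nonneg p T
      size_eq_zero := fun X E F _ _ _ _ _ _ _ _ T hT => eq_zero_of_size_cohenLipL_eq_zero hT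
      size_smul := fun X E F _ _ _ _ _ _ _ _ T hT c => size_cohenLipL_smul hT c
      size_add := fun X E F _ _ _ _ _ _ _ _ T hT S hS =>
        ((cohenBound_size hT).add (cohenBound_size hS)).size_le
          (add_nonneg (size_cohenLipL_nonneg p T) (size_cohenLipL_nonneg p S))
      complete := fun X E F _ _ _ _ _ _ _ _ T hT hcau => exists_limit_cohenLipL hT hcau
      lipLNorm_le := fun X E F _ _ _ _ _ _ _ _ T hT =>
        (isClosedUpper_lipLBound T).sInf_le (size_cohenLipL_nonneg p T) (lipLBound_size hT)
      size_mul := size_cohenLipL_mul hp }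
  intro X X₀ E E₀ F F₀ _ _ _ _ _ _ _ _ _ _ _ _ _ _ _ _ f v T u hf hT
  have hbd := (cohenBound_size hT).comp (lipConst_nonneg f) (dist_le_lipConst_mul hf.1) v
    (size_cohenLipL_nonneg p T) u
  refine ⟨hbd.mem (fun x => ⟨fun e e' => ?_, fun c e => ?_⟩) fun e => ?_, hbd.size_le ?_⟩
  · rw [map_add, (hT.1.1 (f x)).map_add, map_add]
  · rw [map_smul, (hT.1.1 (f x)).map_smul, map_smul]
  · simp only [hf.2, hT.1.2.2, map_zero]
  · exact mul_nonneg (mul_nonneg (mul_nonneg (norm_nonneg _) (size_cohenLipL_nonneg p T))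
      (lipConst_nonneg f)) (norm_nonneg _)

/-! ### Factorization through a quotient of `ℓ₁` -/

theorem summable_norm_lp_one {Γ : Type u} (h : lp (fun _ : Γ => ℝ) 1) :
    Summable fun γ => ‖h γ‖ := by
  simpa using (memℓp_gen_iff (p := 1) (by simp)).1 (lp.memℓp h)

theorem norm_lp_one {Γ : Type u} (h : lp (fun _ : Γ => ℝ) 1) : ‖h‖ = ∑' γ, ‖h γ‖ := by
  simpa using lp.norm_eq_tsum_rpow (p := 1) (by simp) h

/-- The bounded operator on `ℓ₁(Γ)` that sends the unit vectors to a given bounded family. -/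
theorem exists_lp_one_lift {Γ F : Type u} [NormedAddCommGroup F] [NormedSpace ℝ F]
    [CompleteSpace F] (v : Γ → F) (L : ℝ) (hv : ∀ γ, ‖v γ‖ ≤ L) :
    ∃ U : lp (fun _ : Γ => ℝ) 1 →L[ℝ] F, ∀ h, HasSum (fun γ => h γ • v γ) (U h) := by
  have hle : ∀ (h : lp (fun _ : Γ => ℝ) 1) γ, ‖h γ • v γ‖ ≤ ‖h γ‖ * L := fun h γ => by
    rw [norm_smul]
    gcongr
    exact hv γ
  have hs : ∀ h : lp (fun _ : Γ => ℝ) 1, Summable fun γ => h γ • v γ := fun h =>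
    Summable.of_norm_bounded ((summable_norm_lp_one h).mul_right L) (hle h)
  refine ⟨LinearMap.mkContinuous
    { toFun := fun h => ∑' γ, h γ • v γ
      map_add' := fun g h => by
        simpa [add_smul] using (hs g).tsum_add (hs h)
      map_smul' := fun c h => by
        simpa [mul_smul] using (hs h).tsum_const_smul c } L fun h => ?_, fun h => (hs h).hasSum⟩
  refine tsum_of_norm_bounded ?_ (hle h)
  rw [mul_comm, norm_lp_one]
  exact (summable_norm_lp_one h).hasSum.mul_right L

/-- The last clause is what makes this factorization useful: in the image under `u` of the unit ball
of `G`, no functional exceeds its bound on the normalized difference quotients of `T`. -/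
theorem exists_factorization {X E F : Type u} [MetricSpace X] [Zero X] [NormedAddCommGroup E]
    [NormedSpace ℝ E] [NormedAddCommGroup F] [NormedSpace ℝ F] [CompleteSpace F]
    {T : X × E → F} (hT : T ∈ LipL0 X E F) :
    ∃ (G : Type u) (_ : NormedAddCommGroup G) (_ : NormedSpace ℝ G) (_ : CompleteSpace G)
      (S : X × E → G) (u : G →L[ℝ] F), S ∈ LipL0 X E G ∧ LipLBound S 1 ∧ T = u ∘ S ∧
      ∀ (z : StrongDual ℝ F) (K : ℝ), (∀ (x y : X) (e : E),
        |z ((dist x y * ‖e‖)⁻¹ • (T (x, e) - T (y, e)))| ≤ K) → ∀ g, |z (u g)| ≤ K * ‖g‖ := by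
  classical
  obtain ⟨hlin, ⟨L, hL, hbd⟩, hzero⟩ := hT
  let v : X × X × E → F := fun γ =>
    (dist γ.1 γ.2.1 * ‖γ.2.2‖)⁻¹ • (T (γ.1, γ.2.2) - T (γ.2.1, γ.2.2))
  have hv : ∀ γ, ‖v γ‖ ≤ L := fun ⟨x, y, e⟩ => by
    simp only [v]
    rw [norm_smul, norm_inv, Real.norm_of_nonneg (by positivity)]
    exact inv_mul_le_of_le_mul₀ (by positivity) hL.le (by
      simpa [mul_comm, mul_left_comm, mul_assoc] using hbd x y e)
  have hdv : ∀ x y e, (dist x y * ‖e‖) • v (x, y, e) = T (x, e) - T (y, e) := fun x y e => by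
    simp only [v]
    -- In the degenerate case the inverse is 0, hence so is `v`; the Lip-linear estimate makes the
    -- increment of `T` vanish as well.
    rcases eq_or_ne (dist x y * ‖e‖) 0 with h0 | h0
    · have := hbd x y e
      rw [mul_assoc, h0, mul_zero, norm_le_zero_iff] at this
      rw [h0, this, zero_smul]
    · rw [smul_inv_smul₀ h0]
  obtain ⟨U, hU⟩ := exists_lp_one_lift v L hv
  let N : Submodule ℝ (lp (fun _ : X × X × E => ℝ) 1) := LinearMap.ker U.toLinearMap
  have hN : IsClosed (N : Set (lp (fun _ : X × X × E => ℝ) 1)) := U.isClosed_ker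
  have : IsClosed (N.toAddSubgroup : Set (lp (fun _ : X × X × E => ℝ) 1)) := hN
  let δ : X → X → E → lp (fun _ : X × X × E => ℝ) 1 := fun x y e =>
    lp.single 1 (x, y, e) (dist x y * ‖e‖)
  have hδ : ∀ x y e, U (δ x y e) = T (x, e) - T (y, e) := fun x y e => by
    rw [← hdv]
    refine (hU _).unique ?_
    convert hasSum_single (x, y, e) ?_ using 1
    · simp [δ]
    · intro γ hγ
      simp only [δ]
      rw [lp.single_apply_ne _ _ _ hγ, zero_smul]
  have hδn : ∀ x y e, ‖δ x y e‖ = dist x y * ‖e‖ := fun x y e => by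
    rw [lp.norm_single zero_lt_one, Real.norm_of_nonneg (by positivity)]
  let w : (lp (fun _ : X × X × E => ℝ) 1 ⧸ N) →ₗ[ℝ] F := N.liftQ U.toLinearMap le_rfl
  have hw : Function.Injective w := LinearMap.ker_eq_bot.1 (N.ker_liftQ_eq_bot _ _ le_rfl)
  have hwmk : ∀ h, w (N.mkQ h) = U h := fun h => rfl
  -- The quotient norm is an infimum over representatives, so bounds for `U` descend to `w`. Taking
  -- `s` to be the norm gives continuity; taking `s = |z ·|` gives the final estimate.
  have key : ∀ g, ∀ B : ℝ, 0 ≤ B → ∀ s : F → ℝ, (∀ h, s (U h) ≤ B * ‖h‖) →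
      s (w g) ≤ B * ‖g‖ := fun g B hB s hs => by
    refine le_of_forall_pos_le_add fun ε hε => ?_
    have hB' : 0 < B + 1 := by positivity
    obtain ⟨m, rfl, hm⟩ := Submodule.Quotient.norm_mk_lt g (div_pos hε hB')
    calc s (w (N.mkQ m)) ≤ B * ‖m‖ := hs m
      _ ≤ B * (‖(Submodule.Quotient.mk m : lp (fun _ : X × X × E => ℝ) 1 ⧸ N)‖ + ε / (B + 1)) := by
        gcongr
      _ ≤ _ := by
        rw [mul_add]
        gcongr
        rw [mul_div_assoc', div_le_iff₀ hB']
        nlinarith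
  let u : (lp (fun _ : X × X × E => ℝ) 1 ⧸ N) →L[ℝ] F := w.mkContinuous ‖U‖ fun g =>
    key g _ (norm_nonneg _) (fun f => ‖f‖) U.le_opNorm
  have hS : ∀ x e, w (N.mkQ (δ x 0 e)) = T (x, e) := fun x e => by
    rw [hwmk, hδ, hzero, sub_zero]
  -- The vectors `δ x 0 e - δ y 0 e` and `δ x y e` generally differ in `ℓ₁`, but `U` takes the same
  -- value on them, so their classes coincide.
  have hSbd : LipLBound (fun a : X × E => N.mkQ (δ a.1 0 a.2)) 1 := fun x y e => by
    have : N.mkQ (δ x 0 e) - N.mkQ (δ y 0 e) = N.mkQ (δ x y e) := hw (by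
      rw [map_sub, hS, hS, hwmk, hδ])
    simp only [this]
    rw [one_mul, ← hδn]
    exact Submodule.Quotient.norm_mk_le _ _
  refine ⟨lp (fun _ : X × X × E => ℝ) 1 ⧸ N, inferInstance, inferInstance, inferInstance,
    fun a => N.mkQ (δ a.1 0 a.2), u, ⟨fun x => ⟨fun e e' => hw ?_, fun c e => hw ?_⟩,
      ⟨1, one_pos, hSbd⟩, fun e => hw ?_⟩, hSbd, funext fun a => (hS a.1 a.2).symm, ?_⟩
  · rw [map_add, hS, hS, hS]
    exact (hlin x).map_add e e'
  · rw [map_smul, hS, hS]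
    exact (hlin x).map_smul c e
  · rw [hS, hzero, map_zero]
  · intro z K hK g
    refine key g K ((abs_nonneg _).trans (hK 0 0 0)) (fun f => |z f|) fun h => ?_
    have hsum := (hU h).mapL z
    rw [← hsum.tsum_eq, ← Real.norm_eq_abs, norm_lp_one]
    refine tsum_of_norm_bounded ((summable_norm_lp_one h).hasSum.mul_left K) fun γ => ?_
    rw [map_smul, norm_smul, mul_comm]
    gcongr
    exact hK _ _ _

/-! ### Transfer of the summing inequality to the quotient. -/

/-- In the application `N i` is the supremum of `|z i|` over the difference quotients and `l i` is
`‖g i‖`. By linearity in the second variable, the weight `l i` can be absorbed into the vector at a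
nearly optimal point. -/
theorem CohenBound.sum_mul_iSup_le {X E F : Type u} [MetricSpace X] [NormedAddCommGroup E]
    [NormedSpace ℝ E] [NormedAddCommGroup F] [NormedSpace ℝ F] {p : ℝ≥0∞} [Fact (1 ≤ p)]
    {T : X × E → F} (hlin : ∀ x, IsLinearMap ℝ fun e : E => T (x, e)) {C : ℝ} (hC : 0 ≤ C)
    (hT : CohenBound p T C) {n : ℕ} (z : Fin n → StrongDual ℝ F) (N l : Fin n → ℝ)
    (hl : ∀ i, 0 ≤ l i)
    (hN : ∀ i, ∀ ε : ℝ, 0 < ε → ∃ (x y : X) (e : E),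
      N i ≤ |z i ((dist x y * ‖e‖)⁻¹ • (T (x, e) - T (y, e)))| + ε) :
    ∑ i, N i * l i ≤ C * finLpNorm p l * weakLpNorm p.conjExponent z := by
  have : Fact (1 ≤ p.conjExponent) := ⟨one_le_conjExponent p⟩
  have hl' : 0 < ∑ i, l i + 1 := add_pos_of_nonneg_of_pos (Finset.sum_nonneg fun i _ => hl i) one_pos
  refine le_of_forall_pos_le_add fun ε hε => ?_
  choose x y e h using fun i => hN i (ε / (∑ i, l i + 1)) (by positivity)
  -- This scaling gives `dist (x i) (y i) * ‖a i • e i‖ = l i`, or 0 in the degenerate case, so only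
  -- an inequality is claimed below.
  let a : Fin n → ℝ := fun i => l i * (dist (x i) (y i) * ‖e i‖)⁻¹
  have ha : ∀ i, 0 ≤ a i := fun i => mul_nonneg (hl i) (by positivity)
  have key := hT n x y (fun i => a i • e i) z
  have hmono : finLpNorm p (fun i => dist (x i) (y i) * ‖a i • e i‖) ≤ finLpNorm p l := by
    refine finLpNorm_mono p fun i => ?_
    rw [abs_of_nonneg (by positivity), norm_smul, Real.norm_of_nonneg (ha i)]
    calc dist (x i) (y i) * (a i * ‖e i‖)
        = l i * ((dist (x i) (y i) * ‖e i‖)⁻¹ * (dist (x i) (y i) * ‖e i‖)) := by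
          simp only [a]; ring
      _ ≤ l i := mul_le_of_le_one_right (hl i) (inv_mul_le_one)
  have hterm : ∀ i, |z i ((dist (x i) (y i) * ‖e i‖)⁻¹ • (T (x i, e i) - T (y i, e i)))| * l i =
      |z i (T (x i, a i • e i) - T (y i, a i • e i))| := fun i => by
    rw [(hlin (x i)).map_smul, (hlin (y i)).map_smul, ← smul_sub]
    simp only [a, mul_smul]
    rw [map_smul _ (l i), smul_eq_mul, abs_mul, abs_of_nonneg (hl i), mul_comm]
  calc ∑ i, N i * l i
      ≤ ∑ i, (|z i (T (x i, a i • e i) - T (y i, a i • e i))| + ε / (∑ i, l i + 1) * l i) := by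
        gcongr with i
        rw [← hterm, ← add_mul]
        exact mul_le_mul_of_nonneg_right (h i) (hl i)
    _ ≤ C * finLpNorm p l * weakLpNorm p.conjExponent z + ε := by
        rw [Finset.sum_add_distrib, ← Finset.mul_sum]
        gcongr ?_ + ?_
        · refine key.trans ?_
          gcongr
          exact weakLpNorm_nonneg _ z
        · rw [div_mul_eq_mul_div, div_le_iff₀ hl']
          gcongr
          exact le_add_of_nonneg_right zero_le_one

theorem CohenBound.exists_factorization {X E F : Type u} [MetricSpace X] [Zero X]
    [NormedAddCommGroup E] [NormedSpace ℝ E] [NormedAddCommGroup F] [NormedSpace ℝ F]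
    [CompleteSpace F] {p : ℝ≥0∞} [Fact (1 ≤ p)] {T : X × E → F} (hT : T ∈ LipL0 X E F) {C : ℝ}
    (hC : 0 ≤ C) (hTC : CohenBound p T C) :
    ∃ (G : Type u) (_ : NormedAddCommGroup G) (_ : NormedSpace ℝ G) (_ : CompleteSpace G)
      (S : X × E → G) (u : G →L[ℝ] F), S ∈ LipL0 X E G ∧ LipLBound S 1 ∧ T = u ∘ S ∧
      StronglySummingBound p u C := by
  obtain ⟨G, i₁, i₂, i₃, S, u, hS, hS1, hTS, hu⟩ := CohenLip.exists_factorization hT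
  refine ⟨G, i₁, i₂, i₃, S, u, hS, hS1, hTS, fun n g z => ?_⟩
  obtain ⟨hlin, ⟨L, hL, hbd⟩, -⟩ := hT
  let q : Fin n → X × X × E → ℝ := fun i γ =>
    |z i ((dist γ.1 γ.2.1 * ‖γ.2.2‖)⁻¹ • (T (γ.1, γ.2.2) - T (γ.2.1, γ.2.2)))|
  have : Nonempty (X × X × E) := ⟨(0, 0, 0)⟩
  -- Difference quotients have norm at most `L`, so these suprema are finite.
  have hq : ∀ i, BddAbove (Set.range (q i)) := fun i => by
    refine ⟨‖z i‖ * L, ?_⟩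
    rintro _ ⟨⟨x, y, e⟩, rfl⟩
    refine ((z i).le_opNorm _).trans ?_
    gcongr
    rw [norm_smul, norm_inv, Real.norm_of_nonneg (by positivity)]
    exact inv_mul_le_of_le_mul₀ (by positivity) hL.le (by
      simpa [mul_comm, mul_left_comm, mul_assoc] using hbd x y e)
  calc ∑ i, |z i (u (g i))| ≤ ∑ i, (⨆ γ, q i γ) * ‖g i‖ := by
        gcongr with i
        exact hu (z i) _ (fun x y e => le_ciSup (hq i) (x, y, e)) (g i)
    _ ≤ _ := by
        refine hTC.sum_mul_iSup_le hlin hC z _ _ (fun i => norm_nonneg _) fun i ε hε => ?_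
        obtain ⟨⟨x, y, e⟩, h⟩ := exists_lt_of_lt_ciSup (sub_lt_self (⨆ γ, q i γ) hε)
        exact ⟨x, y, e, by linarith⟩

/-! ### Equality of the two classes and of their norms. -/

theorem StronglySummingBound.cohenBound_comp {X E F G : Type u} [MetricSpace X]
    [NormedAddCommGroup E] [NormedAddCommGroup G] [NormedSpace ℝ G]
    [NormedAddCommGroup F] [NormedSpace ℝ F] {p : ℝ≥0∞} [Fact (1 ≤ p)] {u : G →L[ℝ] F}
    {S : X × E → G} {D L : ℝ} (hD : 0 ≤ D) (hL : 0 ≤ L) (hu : StronglySummingBound p u D)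
    (hS : LipLBound S L) : CohenBound p (u ∘ S) (D * L) := fun n x y e z => by
  have : Fact (1 ≤ p.conjExponent) := ⟨one_le_conjExponent p⟩
  have h := hu n (fun i => S (x i, e i) - S (y i, e i)) z
  simp only [map_sub] at h ⊢
  refine h.trans (mul_le_mul_of_nonneg_right ?_ (weakLpNorm_nonneg _ z))
  rw [mul_assoc]
  refine mul_le_mul_of_nonneg_left ?_ hD
  conv_rhs => rw [← abs_of_nonneg hL, ← finLpNorm_const_mul]
  refine finLpNorm_mono p fun i => ?_
  rw [abs_norm, ← mul_assoc]
  exact hS _ _ _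

theorem cohenLipL_eq_compLipL (p : ℝ≥0∞) [Fact (1 ≤ p)] (X E F : Type u) [MetricSpace X] [Zero X]
    [NormedAddCommGroup E] [NormedSpace ℝ E] [NormedAddCommGroup F] [NormedSpace ℝ F]
    [CompleteSpace F] :
    (cohenLipL.{u} p).mem X E F = (stronglySumming.{u} p).compLipL.mem X E F ∧
      ∀ T ∈ (cohenLipL.{u} p).mem X E F,
        (cohenLipL.{u} p).size X E F T = (stronglySumming.{u} p).compLipL.size X E F T := by
  -- Every Cohen constant dominates the value of some factorization, and conversely every such value
  -- is a Cohen constant; together these give equality of the infima.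
  have hforward : ∀ (T : X × E → F), T ∈ LipL0 X E F → ∀ C : ℝ, 0 < C → CohenBound p T C →
      ∃ r ≤ C, FactorsWith (stronglySumming.{u} p) T r := fun T hT C hC hTC => by
    obtain ⟨G, i₁, i₂, i₃, S, u, hS, hS1, hTS, hu⟩ := hTC.exists_factorization hT hC.le
    refine ⟨_, ?_, G, i₁, i₂, i₃, S, u, hS, ⟨C, hC, hu⟩, hTS, rfl⟩
    calc _ ≤ C * 1 := mul_le_mul
          ((isClosedUpper_stronglySummingBound p u).sInf_le hC.le hu)
          ((isClosedUpper_lipLBound S).sInf_le zero_le_one hS1) (sInf_pos_and_nonneg _) hC.le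
      _ = C := mul_one C
  have hbackward : ∀ (T : X × E → F) (r : ℝ), FactorsWith (stronglySumming.{u} p) T r →
      0 ≤ r ∧ CohenBound p T r := by
    rintro _ _ ⟨G, i₁, i₂, i₃, S, u, hS, hu, rfl, rfl⟩
    exact ⟨mul_nonneg (sInf_pos_and_nonneg _) (sInf_pos_and_nonneg _),
      StronglySummingBound.cohenBound_comp (sInf_pos_and_nonneg _) (sInf_pos_and_nonneg _)
        ((isClosedUpper_stronglySummingBound p u).sInf_mem hu)
        ((isClosedUpper_lipLBound S).sInf_mem hS.2.1)⟩
  refine ⟨Set.ext fun T => and_congr_right fun hT => ⟨?_, ?_⟩, fun T hT => le_antisymm ?_ ?_⟩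
  · rintro ⟨C, hC, hTC⟩
    obtain ⟨r, -, hr⟩ := hforward T hT C hC hTC
    exact ⟨r, hr⟩
  · rintro ⟨r, hr⟩
    exact (isClosedUpper_cohenBound p T).exists_pos (hbackward T r hr).2
  · obtain ⟨hT, C, hC, hTC⟩ := hT
    obtain ⟨r, -, hr⟩ := hforward T hT C hC hTC
    exact le_csInf ⟨r, hr⟩ fun r hr =>
      (isClosedUpper_cohenBound p T).sInf_le (hbackward T r hr).1 (hbackward T r hr).2
  · refine le_csInf hT.2 fun C hC => ?_
    obtain ⟨r, hrC, hr⟩ := hforward T hT.1 C hC.1 hC.2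
    exact (csInf_le ⟨0, fun r hr => (hbackward T r hr).1⟩ hr).trans hrC

end

end CohenLip

theorem mainTheorem4 (p : ℝ≥0∞) (hp : 1 < p) :
    CohenLip.IsBanachLipLIdeal (CohenLip.cohenLipL.{u} p) ∧
    ∀ (X E F : Type u) [MetricSpace X] [Zero X]
      [NormedAddCommGroup E] [NormedSpace ℝ E] [CompleteSpace E]
      [NormedAddCommGroup F] [NormedSpace ℝ F] [CompleteSpace F],
      (CohenLip.cohenLipL.{u} p).mem X E F =
        (CohenLip.stronglySumming.{u} p).compLipL.mem X E F ∧
      ∀ T ∈ (CohenLip.cohenLipL.{u} p).mem X E F,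
        (CohenLip.cohenLipL.{u} p).size X E F T =
          (CohenLip.stronglySumming.{u} p).compLipL.size X E F T := by
  have : Fact (1 ≤ p) := ⟨hp.le⟩
  exact ⟨CohenLip.isBanachLipLIdeal_cohenLipL p hp, fun X E F _ _ _ _ _ _ _ _ =>
    CohenLip.cohenLipL_eq_compLipL p X E F⟩
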